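/- Let $\mathcal M=\{M_x\}_x$ denote a POVM with finitely many outcomes on $\mathbb C^d$. Its measurement information channel (MIC) and the matrix representation of that channel are $$\mathcal H_{\mathcal M}(A)=\sum_x M_x\frac{\mathrm{Tr}[M_xA]}{\mathrm{Tr}[M_x]},\qquad \mathcal C_{\mathcal M}=\sum_x\frac{\mathrm{vec}(M_x)\,\mathrm{vec}(M_x)^\dagger}{\mathrm{Tr}[M_x]}\in\mathbb C^{d^2\times d^2}$$ (terms with $M_x=0$ are $0$). Write $\|\mathcal H_{\mathcal M}\|_{HS}$ and $\|\mathcal H_{\mathcal M}\|_1$ for the $\ell_2$ and $\ell_1$ norms of the singular values of $\mathcal C_{\mathcal M}$. Let $\mathfrak M$ be a set of POVMs on $\mathbb C^d$, let $n\ge 1$ and $\mathcal M_1,\dots,\mathcal M_n\in\mathfrak M$, and put $\overline{\mathcal H}=\frac1n\sum_i\mathcal H_{\mathcal M_i}$ and $\overline{\mathcal C}=\frac1n\sum_i\mathcal C_{\mathcal M_i}$. Let $c,\varepsilon>0$, let $\ell$ be an integer with $d^2/2\le\ell\le d^2-1$, and let $\mathcal V=(V_1,\dots,V_{d^2}=\mathbb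 I_d/\sqrt d)$ be an orthonormal basis of the real Hilbert space of Hermitian $d\times d$ matrices with inner product $\mathrm{Tr}[A^\dagger B]$. For $z\in\{-1,1\}^\ell$ put $$\Delta_z=\frac{c\,\varepsilon}{\sqrt d}\cdot\frac1{\sqrt\ell}\sum_{i=1}^{\ell}z_iV_i,\qquad \overline\Delta_z=\Delta_z\min\Big\{1,\frac1{d\,\|\Delta_z\|_{op}}\Big\},\qquad \sigma_z=\frac{\mathbb I_d}{d}+\overline\Delta_z .$$ Let $\sigma=\sigma_z$ and $\sigma'=\sigma_{z'}$ with $z,z'$ independent and uniform on $\{-1,1\}^\ell$, and write $\Delta_\sigma=\sigma-\mathbb I_d/d$ and $$L=\log\mathbb E_{\sigma,\sigma'}\exp\left\{n\,d\;\mathrm{vec}(\Delta_\sigma)^\dagger\,\overline{\mathcal C}\,\mathrm{vec}(\Delta_{\sigma'})\right\}.$$ **Theorem.** For every $c>0$ there is a constant $C>0$, depending only on $c$, such that the following holds for all $d,n,\ell,\varepsilon,\mathcal V,\mathfrak M,\mathcal M_1,\dots,\mathcal M_n$ as above. 1. If $n\le\dfrac{d^2}{6c^2\varepsilon^2\sup_{\mathcal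 M\in\mathfrak M}\|\mathcal H_{\mathcal M}\|_{HS}}$, then $$|L|\le C\,\frac{n^2\varepsilon^4}{d^4}\sup_{\mathcal M\in\mathfrak M}\|\mathcal H_{\mathcal M}\|_{HS}^2 .$$ 2. If $\mathcal V$ is an eigenbasis of $\overline{\mathcal H}$ with eigenvalues $\lambda(V_1)\le\dots\le\lambda(V_{d^2})$, if $\ell=\lceil d^2/2\rceil$, and if $n\le\dfrac{d^3}{9c^2\varepsilon^2\sup_{\mathcal M\in\mathfrak M}\|\mathcal H_{\mathcal M}\|_1}$, then $$|L|\le C\,\frac{n^2\varepsilon^4}{d^6}\sup_{\mathcal M\in\mathfrak M}\|\mathcal H_{\mathcal M}\|_1^2 .$$ -/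

import Mathlib

open Matrix
open scoped BigOperators ComplexOrder

noncomputable section

namespace QuantumCert

/-- The singular values of a square complex matrix, in decreasing order and with multiplicity
(indices from `0`; the value is `0` from the index `Fintype.card m` on). -/
def singVal {m : Type} [Fintype m] [DecidableEq m] (A : Matrix m m ℂ) (i : ℕ) : ℝ :=
  (Matrix.toEuclideanLin A).singularValues i

/-- Trace norm (Schatten 1-norm). -/
def traceNorm {m : Type} [Fintype m] [DecidableEq m] (A : Matrix m m ℂ) : ℝ :=
  ∑ i ∈ Finset.range (Fintype.card m), singVal A i

/-- Hilbert-Schmidt norm (Schatten 2-norm). -/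
def hsNorm {m : Type} [Fintype m] [DecidableEq m] (A : Matrix m m ℂ) : ℝ :=
  Real.sqrt (∑ i ∈ Finset.range (Fintype.card m), singVal A i ^ 2)

/-- Operator norm (Schatten ∞-norm): the largest singular value. -/
def opNorm {m : Type} [Fintype m] [DecidableEq m] (A : Matrix m m ℂ) : ℝ :=
  singVal A 0

/-- A POVM on `ℂ^d` with finitely many outcomes. -/
structure POVM (d : ℕ) where
  /-- the number of outcomes -/
  k : ℕ
  /-- the effects `M_x` -/
  eff : Fin k → Matrix (Fin d) (Fin d) ℂ
  posSemidef : ∀ x, (eff x).PosSemidef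
  sum_eq_one : ∑ x, eff x = 1

/-- The measurement information channel `A ↦ ∑ₓ Mₓ Tr[Mₓ A] / Tr[Mₓ]`.
A zero effect contributes `0`. -/
def mic {d : ℕ} (M : POVM d) (A : Matrix (Fin d) (Fin d) ℂ) : Matrix (Fin d) (Fin d) ℂ :=
  ∑ x, ((M.eff x * A).trace / (M.eff x).trace) • M.eff x

/-- The matrix representation `∑ₓ vec(Mₓ) vec(Mₓ)† / Tr[Mₓ]` of the measurement information
channel, where `vec` stacks columns. -/
def micMatrix {d : ℕ} (M : POVM d) : Matrix (Fin d × Fin d) (Fin d × Fin d) ℂ :=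
  ∑ x, ((M.eff x).trace)⁻¹ • vecMulVec (vec (M.eff x)) (star (vec (M.eff x)))

/-- `micMatrix M` represents `mic M` with respect to vectorization. The Schatten norms of the
superoperator `mic M` are those of `micMatrix M`, because `vec` is an isometry. -/
theorem micMatrix_mulVec_vec {d : ℕ} (M : POVM d) (A : Matrix (Fin d) (Fin d) ℂ) :
    micMatrix M *ᵥ vec A = vec (mic M A) := by
  unfold micMatrix mic
  rw [Matrix.sum_mulVec, Matrix.vec_sum]
  refine Finset.sum_congr rfl fun x _ => ?_
  have h := (M.posSemidef x).isHermitian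
  rw [Matrix.smul_mulVec, Matrix.vecMulVec_mulVec, Matrix.star_vec_dotProduct_vec, h.eq,
    Matrix.vec_smul]
  ext p
  simp [div_eq_mul_inv]
  ring

/-- The Hilbert-Schmidt norm of the superoperator `mic M`. -/
def micHSNorm {d : ℕ} (M : POVM d) : ℝ := hsNorm (micMatrix M)

/-- The trace norm of the superoperator `mic M`. -/
def micTraceNorm {d : ℕ} (M : POVM d) : ℝ := traceNorm (micMatrix M)

/-- The average measurement information channel of `M₁, …, Mₙ`. -/
def avgMic {d n : ℕ} (M : Fin n → POVM d) (A : Matrix (Fin d) (Fin d) ℂ) :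
    Matrix (Fin d) (Fin d) ℂ :=
  ((n : ℂ)⁻¹) • ∑ i, mic (M i) A

/-- The matrix representation of the average measurement information channel. -/
def avgMicMatrix {d n : ℕ} (M : Fin n → POVM d) :
    Matrix (Fin d × Fin d) (Fin d × Fin d) ℂ :=
  ((n : ℂ)⁻¹) • ∑ i, micMatrix (M i)

/-- The maximally mixed state `I / d`. -/
def maxMixed (d : ℕ) : Matrix (Fin d) (Fin d) ℂ := ((d : ℂ)⁻¹) • 1

/-- `V` is an orthonormal basis `(V_1, …, V_{d²} = I/√d)` of the real Hilbert space of Hermitian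
`d × d` matrices with inner product `Tr[A† B]`; `V_j` is `V ⟨j - 1, _⟩` in Lean. -/
structure IsHermBasis {d : ℕ} (V : Fin (d ^ 2) → Matrix (Fin d) (Fin d) ℂ) : Prop where
  isHermitian : ∀ i, (V i).IsHermitian
  orthonormal : ∀ i j, ((V i)ᴴ * V j).trace = if i = j then 1 else 0
  span : ∀ A : Matrix (Fin d) (Fin d) ℂ, A.IsHermitian → A ∈ Submodule.span ℝ (Set.range V)
  last : ∀ i : Fin (d ^ 2), (i : ℕ) + 1 = d ^ 2 → V i = (((Real.sqrt d)⁻¹ : ℝ) : ℂ) • 1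

/-- The perturbation `Δ_z = (c ε / √d) (1 / √ℓ) ∑_{i ≤ ℓ} z_i V_i` for signs `z ∈ {-1, 1}^ℓ`. -/
def pert {d ℓ : ℕ} (c ε : ℝ) (hℓ : ℓ ≤ d ^ 2) (V : Fin (d ^ 2) → Matrix (Fin d) (Fin d) ℂ)
    (z : Fin ℓ → ℤˣ) : Matrix (Fin d) (Fin d) ℂ :=
  (((c * ε / Real.sqrt d) * (1 / Real.sqrt ℓ) : ℝ) : ℂ) •
    ∑ i : Fin ℓ, (((z i : ℤˣ) : ℤ) : ℂ) • V (Fin.castLE hℓ i)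

/-- The normalized perturbation `Δ_z min {1, 1 / (d ‖Δ_z‖_op)}`. -/
def normPert {d ℓ : ℕ} (c ε : ℝ) (hℓ : ℓ ≤ d ^ 2) (V : Fin (d ^ 2) → Matrix (Fin d) (Fin d) ℂ)
    (z : Fin ℓ → ℤˣ) : Matrix (Fin d) (Fin d) ℂ :=
  ((min 1 (1 / ((d : ℝ) * opNorm (pert c ε hℓ V z))) : ℝ) : ℂ) • pert c ε hℓ V z

/-- The hard instance `σ_z`. The law of `σ_z` for uniform `z ∈ {-1, 1}^ℓ` is the distribution
`D_c(V)`. -/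
def hardState {d ℓ : ℕ} (c ε : ℝ) (hℓ : ℓ ≤ d ^ 2) (V : Fin (d ^ 2) → Matrix (Fin d) (Fin d) ℂ)
    (z : Fin ℓ → ℤˣ) : Matrix (Fin d) (Fin d) ℂ :=
  maxMixed d + normPert c ε hℓ V z

/-- The exponent `n d vec(Δ_σ)† C̄ vec(Δ_σ')` with `Δ_σ = σ - I/d`. For Hermitian `σ`, `σ'` the
complex number of which the real part is taken is real. -/
def exponent {d n : ℕ} (M : Fin n → POVM d) (σ σ' : Matrix (Fin d) (Fin d) ℂ) : ℝ :=
  (n : ℝ) * d *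
    (star (vec (σ - maxMixed d)) ⬝ᵥ (avgMicMatrix M *ᵥ vec (σ' - maxMixed d))).re

/-- `log E exp (n d vec(Δ_σ)† C̄ vec(Δ_σ'))` for independent `σ, σ'` distributed as `D_c(V)`,
that is `σ = σ_z`, `σ' = σ_z'` with independent uniform `z, z' ∈ {-1, 1}^ℓ`. -/
def logMGF {d n ℓ : ℕ} (c ε : ℝ) (hℓ : ℓ ≤ d ^ 2) (V : Fin (d ^ 2) → Matrix (Fin d) (Fin d) ℂ)
    (M : Fin n → POVM d) : ℝ :=
  Real.log (Finset.expect Finset.univ fun z : Fin ℓ → ℤˣ =>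
    Finset.expect Finset.univ fun z' : Fin ℓ → ℤˣ =>
      Real.exp (exponent M (hardState c ε hℓ V z) (hardState c ε hℓ V z')))

/-- `V` is an eigenbasis of the average channel whose eigenvalues satisfy
`λ(V_1) ≤ ⋯ ≤ λ(V_{d²})`. -/
def IsOrderedEigenbasis {d n : ℕ} (M : Fin n → POVM d)
    (V : Fin (d ^ 2) → Matrix (Fin d) (Fin d) ℂ) : Prop :=
  ∃ ev : Fin (d ^ 2) → ℝ, Monotone ev ∧ ∀ i, avgMic M (V i) = ((ev i : ℝ) : ℂ) • V i

end QuantumCert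

end

/-! With $t=nc^2\varepsilon^2/\ell$ and $H$ equal to $t$ times the first $\ell\times\ell$ block of
$\overline{\mathcal C}$ in the basis `V`, the exponent is $z^T H z'$ times damping factors in
$[0,1]$ that are even in $z$ and $z'$. As the exponent is odd in $z$, its exponential has the same
mean as its $\cosh$. So $L\ge 0$, and removing the damping can only increase $L$ (`abs_logMGF_le`).
It remains to bound the moment generating function of the undamped chaos.

For part 1, integrating out $z'$ leaves $\mathbb E\exp(\|H^Tz\|^2/2)$, which Gaussian linearization
and Jensen bound by $\exp\|H\|_{HS}^2$ when $\|H\|_{HS}^2\le 1/2$ (`expect_exp_bilin_le`). The norm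
of $H$ is at most $tS$, with $S$ the supremum.

For part 2, $H$ is diagonal, so for fixed $z$ the chaos is a Rademacher sum. Its coefficients are
small because each of the lower half of the eigenvalues is at most
$2\,\mathrm{Tr}\,\overline{\mathcal C}/d^2$ (`eigenvalue_le`). -/

namespace QuantumCert

/-! ### Exponential moments of Rademacher sums and chaoses -/

/-- The moment generating function of a Rademacher sum. -/
theorem expect_exp_rademacher {ℓ : ℕ} (a : Fin ℓ → ℝ) :
    (𝔼 z : Fin ℓ → ℤˣ, Real.exp (∑ i, a i * ((z i : ℤ) : ℝ))) = ∏ i, Real.cosh (a i) := by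
  have hsum : ∑ z : Fin ℓ → ℤˣ, Real.exp (∑ i, a i * ((z i : ℤ) : ℝ)) =
      ∏ i, (2 * Real.cosh (a i)) := by
    simp_rw [Real.exp_sum]
    rw [← Fintype.piFinset_univ,
      ← Finset.prod_univ_sum (fun _ => Finset.univ)
        (fun i (u : ℤˣ) => Real.exp (a i * ((u : ℤ) : ℝ)))]
    refine Finset.prod_congr rfl fun i _ => ?_
    have : (Finset.univ : Finset ℤˣ) = {1, -1} := rfl
    rw [this, Finset.sum_pair (by decide), Real.cosh_eq]
    simp
    ring
  rw [Fintype.expect_eq_sum_div_card, hsum, Finset.prod_mul_distrib]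
  simp

theorem expect_exp_rademacher_le {ℓ : ℕ} (a : Fin ℓ → ℝ) :
    (𝔼 z : Fin ℓ → ℤˣ, Real.exp (∑ i, a i * ((z i : ℤ) : ℝ))) ≤
      Real.exp ((∑ i, a i ^ 2) / 2) := by
  rw [expect_exp_rademacher, Finset.sum_div, Real.exp_sum]
  exact Finset.prod_le_prod (fun i _ => (Real.cosh_pos _).le)
    fun i _ => Real.cosh_le_exp_half_sq _

section Gaussian
open MeasureTheory ProbabilityTheory

theorem integral_exp_mul_gaussianReal (t : ℝ) :
    ∫ x, Real.exp (t * x) ∂(gaussianReal 0 1) = Real.exp (t ^ 2 / 2) := by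
  have h := congrFun (mgf_id_gaussianReal (μ := 0) (v := 1)) t
  simpa [mgf] using h

theorem exp_sq_mul_gaussianPDFReal (b x : ℝ) :
    gaussianPDFReal 0 1 x * Real.exp (b * x ^ 2) =
      (√(2 * Real.pi))⁻¹ * Real.exp (-(1 / 2 - b) * x ^ 2) := by
  simp only [gaussianPDFReal]
  rw [mul_assoc, ← Real.exp_add]
  congr 2
  · simp
  · simp; ring

theorem integral_exp_sq_gaussianReal {b : ℝ} (hb : b < 1 / 2) :
    ∫ x, Real.exp (b * x ^ 2) ∂(gaussianReal 0 1) = (√(1 - 2 * b))⁻¹ := by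
  rw [integral_gaussianReal_eq_integral_smul one_ne_zero]
  simp_rw [smul_eq_mul, exp_sq_mul_gaussianPDFReal]
  rw [integral_const_mul, integral_gaussian, ← Real.sqrt_inv, ← Real.sqrt_inv,
    ← Real.sqrt_mul (by positivity)]
  congr 1
  have h1 : (1 / 2 - b) ≠ 0 := by linarith
  have h2 : 1 - 2 * b ≠ 0 := by linarith
  have := Real.pi_ne_zero
  field_simp

theorem integrable_exp_sq_gaussianReal {b : ℝ} (hb : b < 1 / 2) :
    Integrable (fun x => Real.exp (b * x ^ 2)) (gaussianReal 0 1) := by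
  refine Integrable.of_integral_ne_zero ?_
  rw [integral_exp_sq_gaussianReal hb]
  have : 0 < √(1 - 2 * b) := Real.sqrt_pos.2 (by linarith)
  positivity

/-- A Rademacher sum with unit variance has the square-exponential moments of a standard
Gaussian as upper bounds. -/
theorem expect_exp_sq_rademacher_le {ℓ : ℕ} {b : ℝ} (hb0 : 0 ≤ b) (hb : b < 1 / 2)
    (u : Fin ℓ → ℝ) (hu : ∑ i, u i ^ 2 = 1) :
    (𝔼 z : Fin ℓ → ℤˣ, Real.exp (b * (∑ i, u i * ((z i : ℤ) : ℝ)) ^ 2)) ≤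
      (√(1 - 2 * b))⁻¹ := by
  -- Linearize the square by a Gaussian $g$: $e^{by^2}=\mathbb E\,e^{\sqrt{2b}\,yg}$. For fixed $g$
  -- the Rademacher bound with $\sum u_i^2=1$ gives $e^{bg^2}$.
  have key : ∀ y : ℝ, Real.exp (b * y ^ 2) =
      ∫ x, Real.exp (√(2 * b) * y * x) ∂(gaussianReal 0 1) := fun y => by
    rw [integral_exp_mul_gaussianReal, mul_pow, Real.sq_sqrt (by positivity)]
    ring_nf
  have hint : ∀ y : ℝ, Integrable (fun x => Real.exp (√(2 * b) * y * x)) (gaussianReal 0 1) :=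
    fun y => integrable_exp_mul_gaussianReal _
  simp_rw [key]
  rw [Fintype.expect_eq_sum_div_card, ← integral_finsetSum _ fun z _ => hint _,
    ← integral_div, ← integral_exp_sq_gaussianReal hb]
  refine integral_mono ((integrable_finsetSum _ fun z _ => hint _).div_const _)
    (integrable_exp_sq_gaussianReal hb) fun x => ?_
  have h := expect_exp_rademacher_le fun i => √(2 * b) * x * u i
  simp only [mul_pow, ← Finset.mul_sum, hu, Real.sq_sqrt (by positivity : 0 ≤ 2 * b)] at h
  rw [Fintype.expect_eq_sum_div_card] at h
  rw [show 2 * b * x ^ 2 * 1 / 2 = b * x ^ 2 by ring] at h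
  convert! h using 5
  rw [Finset.mul_sum, Finset.sum_mul]
  exact Finset.sum_congr rfl fun i _ => by ring
end Gaussian

/-- With weights $f_k/F$ proportional to the squared row norms, the quadratic form is a convex
combination of squares of unit-variance sums, each scaled by $aF$. Jensen's inequality reduces to a
single row. -/
theorem expect_exp_sum_sq_rademacher_le {ℓ : ℕ} {κ : Type*} [Fintype κ] (h : κ → Fin ℓ → ℝ)
    {a : ℝ} (ha : 0 ≤ a) (hF : a * ∑ k, ∑ i, h k i ^ 2 < 1 / 2) :
    (𝔼 z : Fin ℓ → ℤˣ, Real.exp (a * ∑ k, (∑ i, h k i * ((z i : ℤ) : ℝ)) ^ 2)) ≤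
      (√(1 - 2 * (a * ∑ k, ∑ i, h k i ^ 2)))⁻¹ := by
  set f : κ → ℝ := fun k => ∑ i, h k i ^ 2 with hf
  set F : ℝ := ∑ k, f k with hFdef
  have hf0 : ∀ k, 0 ≤ f k := fun k => Finset.sum_nonneg fun i _ => sq_nonneg _
  have hF0 : 0 ≤ F := Finset.sum_nonneg fun k _ => hf0 k
  have hrow : ∀ k, f k = 0 → ∀ i, h k i = 0 := fun k hk i => by
    have := (Finset.sum_eq_zero_iff_of_nonneg fun i _ => sq_nonneg (h k i)).1 hk i
      (Finset.mem_univ i)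
    simpa using this
  rcases hF0.eq_or_lt with hz | hpos
  · have : ∀ k, f k = 0 := fun k =>
      (Finset.sum_eq_zero_iff_of_nonneg fun k _ => hf0 k).1 hz.symm k (Finset.mem_univ k)
    simp [← hz, fun k i => hrow k (this k) i]
  have hconv : ∀ z : Fin ℓ → ℤˣ,
      Real.exp (a * ∑ k, (∑ i, h k i * ((z i : ℤ) : ℝ)) ^ 2) ≤
        ∑ k, f k / F * Real.exp (a * F * (∑ i, h k i / √(f k) * ((z i : ℤ) : ℝ)) ^ 2) := by
    intro z
    have := convexOn_exp.map_sum_le (t := Finset.univ) (w := fun k => f k / F)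
      (p := fun k => a * F * (∑ i, h k i / √(f k) * ((z i : ℤ) : ℝ)) ^ 2)
      (fun k _ => div_nonneg (hf0 k) hF0) (by rw [← Finset.sum_div, div_self hpos.ne'])
      (fun _ _ => Set.mem_univ _)
    simp only [smul_eq_mul] at this
    convert! this using 2
    rw [Finset.mul_sum]
    refine Finset.sum_congr rfl fun k _ => ?_
    by_cases hk : f k = 0
    · simp [hk, hrow k hk]
    · have e : ∑ i, h k i / √(f k) * ((z i : ℤ) : ℝ) =
          (∑ i, h k i * ((z i : ℤ) : ℝ)) / √(f k) := by
        rw [Finset.sum_div]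
        exact Finset.sum_congr rfl fun i _ => by ring
      rw [e, div_pow, Real.sq_sqrt (hf0 k)]
      have := hpos.ne'
      field_simp
  calc _ ≤ 𝔼 z : Fin ℓ → ℤˣ, ∑ k, f k / F *
        Real.exp (a * F * (∑ i, h k i / √(f k) * ((z i : ℤ) : ℝ)) ^ 2) :=
        Finset.expect_le_expect fun z _ => hconv z
    _ = ∑ k, f k / F * 𝔼 z : Fin ℓ → ℤˣ,
        Real.exp (a * F * (∑ i, h k i / √(f k) * ((z i : ℤ) : ℝ)) ^ 2) := by
        rw [Finset.expect_sum_comm]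
        simp_rw [Finset.mul_expect]
    _ ≤ ∑ k, f k / F * (√(1 - 2 * (a * F)))⁻¹ := by
        refine Finset.sum_le_sum fun k _ => ?_
        by_cases hk : f k = 0
        · simp [hk]
        · refine mul_le_mul_of_nonneg_left ?_ (div_nonneg (hf0 k) hF0)
          refine expect_exp_sq_rademacher_le (by positivity) hF _ ?_
          simp_rw [div_pow, Real.sq_sqrt (hf0 k)]
          rw [← Finset.sum_div]
          exact div_self hk
    _ = _ := by rw [← Finset.sum_mul, ← Finset.sum_div, div_self hpos.ne', one_mul]

/-- A decoupled Rademacher chaos of order two is sub-Gaussian for small parameters. -/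
theorem expect_exp_bilin_le {ℓ : ℕ} (H : Fin ℓ → Fin ℓ → ℝ)
    (hF : ∑ i, ∑ j, H i j ^ 2 ≤ 1 / 2) :
    (𝔼 z : Fin ℓ → ℤˣ, 𝔼 z' : Fin ℓ → ℤˣ,
      Real.exp (∑ i, ∑ j, ((z i : ℤ) : ℝ) * H i j * ((z' j : ℤ) : ℝ))) ≤
      Real.exp (∑ i, ∑ j, H i j ^ 2) := by
  set F := ∑ i, ∑ j, H i j ^ 2 with hFdef
  have hF' : ∑ j, ∑ i, H i j ^ 2 = F := Finset.sum_comm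
  have hF0 : 0 ≤ F := Finset.sum_nonneg fun i _ => Finset.sum_nonneg fun j _ => sq_nonneg _
  have h1 : ∀ z : Fin ℓ → ℤˣ, (𝔼 z' : Fin ℓ → ℤˣ,
      Real.exp (∑ i, ∑ j, ((z i : ℤ) : ℝ) * H i j * ((z' j : ℤ) : ℝ))) ≤
      Real.exp (1 / 2 * ∑ j, (∑ i, H i j * ((z i : ℤ) : ℝ)) ^ 2) := fun z => by
    have := expect_exp_rademacher_le fun j => ∑ i, H i j * ((z i : ℤ) : ℝ)
    rw [div_eq_inv_mul, ← one_div] at this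
    convert! this using 3
    rw [Finset.sum_comm]
    refine Finset.sum_congr rfl fun j _ => ?_
    rw [Finset.sum_mul]
    exact Finset.sum_congr rfl fun i _ => by ring
  refine (Finset.expect_le_expect fun z _ => h1 z).trans ?_
  refine (expect_exp_sum_sq_rademacher_le (fun j i => H i j) (by norm_num)
    (by rw [hF']; linarith)).trans ?_
  rw [hF', show 1 - 2 * (1 / 2 * F) = 1 - F by ring]
  -- This is $e^{-2F}\le 1-F$, from $e^{2F}(1-F)\ge(1+2F)(1-F)\ge 1$; the last inequality needs
  -- $F\le 1/2$.
  have hexp : (Real.exp F)⁻¹ ≤ √(1 - F) := by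
    refine Real.le_sqrt_of_sq_le ?_
    rw [inv_pow, ← Real.exp_nat_mul]
    refine inv_le_of_inv_le₀ (by linarith) ?_
    refine le_trans ?_ (Real.add_one_le_exp _)
    rw [inv_le_iff_one_le_mul₀ (by linarith)]
    push_cast
    nlinarith
  exact inv_le_of_inv_le₀ (Real.exp_pos _) hexp

/-! ### Symmetrization of odd exponents -/

theorem expect_neg_comp {ℓ : ℕ} (f : (Fin ℓ → ℤˣ) → ℝ) : (𝔼 z, f (-z)) = 𝔼 z, f z :=
  Fintype.expect_equiv (Equiv.neg _) _ _ fun _ => rfl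

theorem expect_exp_eq_expect_cosh {ℓ : ℕ} (X : (Fin ℓ → ℤˣ) → (Fin ℓ → ℤˣ) → ℝ)
    (hX : ∀ z z', X (-z) z' = -X z z') :
    (𝔼 z, 𝔼 z', Real.exp (X z z')) = 𝔼 z, 𝔼 z', Real.cosh (X z z') := by
  have h := expect_neg_comp fun z => 𝔼 z', Real.exp (X z z')
  simp_rw [hX] at h
  simp_rw [Real.cosh_eq, ← Finset.expect_div, Finset.expect_add_distrib]
  rw [h]
  ring

/-- Damping an odd exponent can only decrease the expectation of its exponential. -/
theorem expect_exp_mono_of_odd {ℓ : ℕ} {X Y : (Fin ℓ → ℤˣ) → (Fin ℓ → ℤˣ) → ℝ}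
    (hX : ∀ z z', X (-z) z' = -X z z') (hY : ∀ z z', Y (-z) z' = -Y z z')
    (h : ∀ z z', |X z z'| ≤ |Y z z'|) :
    (𝔼 z, 𝔼 z', Real.exp (X z z')) ≤ 𝔼 z, 𝔼 z', Real.exp (Y z z') := by
  rw [expect_exp_eq_expect_cosh X hX, expect_exp_eq_expect_cosh Y hY]
  exact Finset.expect_le_expect fun z _ => Finset.expect_le_expect fun z' _ =>
    Real.cosh_le_cosh.2 (h z z')

theorem one_le_expect_exp_of_odd {ℓ : ℕ} {X : (Fin ℓ → ℤˣ) → (Fin ℓ → ℤˣ) → ℝ}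
    (hX : ∀ z z', X (-z) z' = -X z z') :
    1 ≤ 𝔼 z, 𝔼 z', Real.exp (X z z') := by
  have := expect_exp_mono_of_odd (X := fun _ _ => 0) (by simp) hX (by simp)
  simpa using this

/-! ### Schatten norms through entries and traces -/

section SingularValues
variable {m : Type} [Fintype m] [DecidableEq m]

theorem sum_range_card_singVal (f : ℝ → ℝ) (A : Matrix m m ℂ) :
    ∑ i ∈ Finset.range (Fintype.card m), f (singVal A i) =
      ∑ i : Fin (Fintype.card m), f (singVal A i) :=
  (Fin.sum_univ_eq_sum_range (fun i => f (singVal A i)) _).symm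

theorem norm_toEuclideanLin_single_sq (A : Matrix m m ℂ) (j : m) :
    ‖Matrix.toEuclideanLin A (EuclideanSpace.basisFun m ℂ j)‖ ^ 2 = ∑ i, ‖A i j‖ ^ 2 := by
  rw [EuclideanSpace.norm_sq_eq]
  simp [Matrix.toLpLin_apply]

theorem hsNorm_sq (A : Matrix m m ℂ) : hsNorm A ^ 2 = ∑ i, ∑ j, ‖A i j‖ ^ 2 := by
  rw [hsNorm, Real.sq_sqrt (Finset.sum_nonneg fun _ _ => sq_nonneg _),
    sum_range_card_singVal (fun x => x ^ 2)]
  set T := Matrix.toEuclideanLin A with hT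
  have hn : Module.finrank ℂ (EuclideanSpace ℂ m) = Fintype.card m := finrank_euclideanSpace
  have h1 : ∑ i : Fin (Fintype.card m), singVal A i ^ 2 =
      (LinearMap.trace ℂ _ (T.adjoint ∘ₗ T)).re := by
    have := T.isSymmetric_adjoint_comp_self.re_trace_eq_sum_eigenvalues hn
    simp only [RCLike.re_to_complex] at this
    rw [this]
    exact Finset.sum_congr rfl fun i _ => T.sq_singularValues_fin hn i
  rw [h1, LinearMap.trace_eq_sum_inner _ (EuclideanSpace.basisFun m ℂ), Complex.re_sum,
    Finset.sum_comm]
  refine Finset.sum_congr rfl fun j _ => ?_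
  rw [LinearMap.comp_apply, LinearMap.adjoint_inner_right, inner_self_eq_norm_sq_to_K,
    ← norm_toEuclideanLin_single_sq]
  norm_cast

theorem hsNorm_nonneg (A : Matrix m m ℂ) : 0 ≤ hsNorm A := Real.sqrt_nonneg _

/-- Take the trace in an eigenbasis $b_i$ of $T^\dagger T$, where $\|Tb_i\|$ is the $i$-th singular
value, and apply Cauchy–Schwarz. -/
theorem re_trace_le_traceNorm (A : Matrix m m ℂ) : A.trace.re ≤ traceNorm A := by
  rw [traceNorm, sum_range_card_singVal (fun x => x)]
  set T := Matrix.toEuclideanLin A with hT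
  have hn : Module.finrank ℂ (EuclideanSpace ℂ m) = Fintype.card m := finrank_euclideanSpace
  have htr : LinearMap.trace ℂ _ T = A.trace := by
    rw [LinearMap.trace_eq_sum_inner _ (EuclideanSpace.basisFun m ℂ), Matrix.trace]
    refine Finset.sum_congr rfl fun j _ => ?_
    simp [hT, Matrix.toLpLin_apply, EuclideanSpace.inner_single_left]
  set b := T.isSymmetric_adjoint_comp_self.eigenvectorBasis hn with hb
  rw [← htr, LinearMap.trace_eq_sum_inner _ b, Complex.re_sum]
  refine Finset.sum_le_sum fun i _ => ?_
  have hbi : ‖b i‖ = 1 := b.orthonormal.1 i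
  have hnorm : ‖T (b i)‖ ^ 2 = T.singularValues i ^ 2 := by
    have h : inner ℂ (b i) ((T.adjoint ∘ₗ T) (b i)) =
        ((T.singularValues i ^ 2 : ℝ) : ℂ) := by
      rw [hb, T.isSymmetric_adjoint_comp_self.apply_eigenvectorBasis hn, ← hb, inner_smul_right,
        inner_self_eq_norm_sq_to_K, hbi, T.sq_singularValues_fin hn]
      simp
    rw [LinearMap.comp_apply, LinearMap.adjoint_inner_right, inner_self_eq_norm_sq_to_K] at h
    exact Complex.ofReal_injective (by simpa using h)
  have hle : ‖T (b i)‖ = T.singularValues i :=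
    (pow_left_inj₀ (norm_nonneg _) (T.singularValues_nonneg i) two_ne_zero).1 hnorm
  calc (inner ℂ (b i) (T (b i))).re ≤ ‖inner ℂ (b i) (T (b i))‖ := Complex.re_le_norm _
    _ ≤ ‖b i‖ * ‖T (b i)‖ := norm_inner_le_norm _ _
    _ = singVal A i := by rw [hbi, one_mul, hle]; rfl

theorem traceNorm_le_card_mul_hsNorm (A : Matrix m m ℂ) :
    traceNorm A ≤ Fintype.card m * hsNorm A := by
  have : traceNorm A ≤ ∑ i ∈ Finset.range (Fintype.card m), hsNorm A :=
    Finset.sum_le_sum fun i hi => Real.le_sqrt_of_sq_le <|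
      Finset.single_le_sum (f := fun i => singVal A i ^ 2) (fun _ _ => sq_nonneg _) hi
  simpa using this

/-- Singular values depend on $T$ only through $T^\dagger T$. This makes the damping even in $z$. -/
theorem opNorm_neg (A : Matrix m m ℂ) : opNorm (-A) = opNorm A := by
  have key : ∀ S T : EuclideanSpace ℂ m →ₗ[ℂ] EuclideanSpace ℂ m,
      S.adjoint ∘ₗ S = T.adjoint ∘ₗ T → S.singularValues = T.singularValues := by
    intro S T h
    have : ∀ (P Q : EuclideanSpace ℂ m →ₗ[ℂ] EuclideanSpace ℂ m) (hP : P.IsSymmetric)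
        (hQ : Q.IsSymmetric), P = Q → hP.eigenvalues rfl = hQ.eigenvalues rfl := by
      rintro P _ hP hQ rfl
      rfl
    unfold LinearMap.singularValues
    simp_rw [this _ _ S.isSymmetric_adjoint_comp_self T.isSymmetric_adjoint_comp_self h]
  unfold opNorm singVal
  rw [key _ (Matrix.toEuclideanLin A)]
  rw [map_neg, map_neg, LinearMap.neg_comp, LinearMap.comp_neg, neg_neg]

theorem opNorm_nonneg (A : Matrix m m ℂ) : 0 ≤ opNorm A := LinearMap.singularValues_nonneg _ _

end SingularValues

/-! ### Frobenius norm and entries of positive matrices -/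

section Frobenius

theorem sum_norm_sq_eq_re_trace {m n : Type*} [Fintype m] [Fintype n] (A : Matrix m n ℂ) :
    ∑ i, ∑ j, ‖A i j‖ ^ 2 = (Aᴴ * A).trace.re := by
  rw [Finset.sum_comm, Matrix.trace, Complex.re_sum]
  refine Finset.sum_congr rfl fun j _ => ?_
  rw [Matrix.diag_apply, Matrix.mul_apply, Complex.re_sum]
  refine Finset.sum_congr rfl fun i _ => ?_
  rw [conjTranspose_apply, ← Complex.normSq_eq_norm_sq, Complex.star_def,
    ← Complex.normSq_eq_conj_mul_self, Complex.ofReal_re]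

theorem norm_apply_le_re_trace {m : Type*} [Fintype m] [DecidableEq m] {A : Matrix m m ℂ}
    (hA : A.PosSemidef) (i j : m) : ‖A i j‖ ≤ A.trace.re := by
  obtain ⟨B, rfl⟩ : ∃ B : Matrix m m ℂ, A = Bᴴ * B := by
    open scoped MatrixOrder in
    obtain ⟨B, hB⟩ := CStarAlgebra.nonneg_iff_eq_star_mul_self.1 hA.nonneg
    exact ⟨B, hB⟩
  rw [← sum_norm_sq_eq_re_trace, Matrix.mul_apply]
  refine (norm_sum_le _ _).trans (Finset.sum_le_sum fun k _ => ?_)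
  rw [conjTranspose_apply, norm_mul, norm_star]
  have hi : ‖B k i‖ ^ 2 ≤ ∑ j, ‖B k j‖ ^ 2 := Finset.single_le_sum (f := fun j => ‖B k j‖ ^ 2) (fun _ _ => sq_nonneg _)
    (Finset.mem_univ i)
  have hj : ‖B k j‖ ^ 2 ≤ ∑ j, ‖B k j‖ ^ 2 := Finset.single_le_sum (f := fun j => ‖B k j‖ ^ 2) (fun _ _ => sq_nonneg _)
    (Finset.mem_univ j)
  nlinarith [sq_nonneg (‖B k i‖ - ‖B k j‖)]

end Frobenius

/-! ### Norm bounds for measurement information channels -/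

section Channel
variable {d : ℕ}

theorem norm_micMatrix_apply_le (M : POVM d) (p q : Fin d × Fin d) :
    ‖micMatrix M p q‖ ≤ d := by
  have htr : ∀ x, ‖(M.eff x).trace‖ = (M.eff x).trace.re := fun x =>
    (Complex.norm_of_nonneg' (M.posSemidef x).trace_nonneg).symm ▸ by simp
  have hsum : ∑ x, (M.eff x).trace.re = d := by
    rw [← Complex.re_sum, ← Matrix.trace_sum, M.sum_eq_one]
    simp
  rw [micMatrix, Matrix.sum_apply, ← hsum]
  refine (norm_sum_le _ _).trans (Finset.sum_le_sum fun x _ => ?_)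
  rw [Matrix.smul_apply, vecMulVec_apply, smul_eq_mul, norm_mul, norm_mul, norm_inv, htr,
    Pi.star_apply, norm_star]
  have h1 : ‖vec (M.eff x) p‖ ≤ (M.eff x).trace.re := norm_apply_le_re_trace (M.posSemidef x) _ _
  have h2 : ‖vec (M.eff x) q‖ ≤ (M.eff x).trace.re := norm_apply_le_re_trace (M.posSemidef x) _ _
  have h0 : 0 ≤ (M.eff x).trace.re := htr x ▸ norm_nonneg _
  calc _ ≤ ((M.eff x).trace.re)⁻¹ * ((M.eff x).trace.re * (M.eff x).trace.re) := by gcongr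
    _ = (M.eff x).trace.re := by
      rcases h0.eq_or_lt with h | h
      · simp [← h]
      · field_simp

theorem micHSNorm_le (M : POVM d) : micHSNorm M ≤ d ^ 3 := by
  refine abs_le_of_sq_le_sq' ?_ (by positivity) |>.2
  rw [micHSNorm, hsNorm_sq]
  calc _ ≤ ∑ _p : Fin d × Fin d, ∑ _q : Fin d × Fin d, (d : ℝ) ^ 2 := by
        gcongr
        exact norm_micMatrix_apply_le M _ _
    _ = _ := by simp; ring

/-- Boundedness is what makes the real `sSup` dominate each member; only finiteness matters, so the
bound is crude. -/
theorem bddAbove_micHSNorm (S : Set (POVM d)) : BddAbove (micHSNorm '' S) :=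
  ⟨d ^ 3, by rintro _ ⟨M, _, rfl⟩; exact micHSNorm_le M⟩

theorem bddAbove_micTraceNorm (S : Set (POVM d)) : BddAbove (micTraceNorm '' S) :=
  ⟨Fintype.card (Fin d × Fin d) * d ^ 3, by
    rintro _ ⟨M, _, rfl⟩
    refine (traceNorm_le_card_mul_hsNorm _).trans ?_
    gcongr
    exact micHSNorm_le M⟩

theorem posSemidef_micMatrix (M : POVM d) : (micMatrix M).PosSemidef :=
  Matrix.posSemidef_sum _ fun x _ =>
    (posSemidef_vecMulVec_self_star _).smul (inv_nonneg.2 (M.posSemidef x).trace_nonneg)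

variable {n : ℕ}

theorem posSemidef_avgMicMatrix (M : Fin n → POVM d) : (avgMicMatrix M).PosSemidef :=
  (Matrix.posSemidef_sum _ fun i _ => posSemidef_micMatrix (M i)).smul
    (inv_nonneg.2 (Nat.cast_nonneg n))

theorem avgMicMatrix_mulVec_vec (M : Fin n → POVM d) (A : Matrix (Fin d) (Fin d) ℂ) :
    avgMicMatrix M *ᵥ vec A = vec (avgMic M A) := by
  simp only [avgMicMatrix, avgMic, smul_mulVec, sum_mulVec, micMatrix_mulVec_vec, vec_smul,
    vec_sum]

/-- Convexity of the squared Hilbert–Schmidt norm, by Cauchy–Schwarz in each entry. -/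
theorem sum_norm_avgMicMatrix_sq_le (hn : 1 ≤ n) (M : Fin n → POVM d) {S : ℝ}
    (hS : ∀ i, micHSNorm (M i) ≤ S) :
    ∑ p, ∑ q, ‖avgMicMatrix M p q‖ ^ 2 ≤ S ^ 2 := by
  have hn0 : (0 : ℝ) < n := by exact_mod_cast hn
  have hent : ∀ p q, ‖avgMicMatrix M p q‖ ^ 2 ≤ (∑ i, ‖micMatrix (M i) p q‖ ^ 2) / n := by
    intro p q
    have h1 : ‖avgMicMatrix M p q‖ ≤ (∑ i, ‖micMatrix (M i) p q‖) / n := by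
      rw [avgMicMatrix, Matrix.smul_apply, Matrix.sum_apply, smul_eq_mul, norm_mul, norm_inv,
        Complex.norm_natCast, div_eq_inv_mul]
      gcongr
      exact norm_sum_le _ _
    have h2 := sq_sum_le_card_mul_sum_sq (s := Finset.univ) (f := fun i => ‖micMatrix (M i) p q‖)
    rw [Finset.card_univ, Fintype.card_fin] at h2
    calc _ ≤ ((∑ i, ‖micMatrix (M i) p q‖) / n) ^ 2 := by gcongr
      _ ≤ (n * ∑ i, ‖micMatrix (M i) p q‖ ^ 2) / n ^ 2 := by rw [div_pow]; gcongr
      _ = _ := by field_simp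
  calc _ ≤ ∑ p, ∑ q, (∑ i, ‖micMatrix (M i) p q‖ ^ 2) / n :=
        Finset.sum_le_sum fun p _ => Finset.sum_le_sum fun q _ => hent p q
    _ = (∑ i, micHSNorm (M i) ^ 2) / n := by
        simp_rw [micHSNorm, hsNorm_sq, ← Finset.sum_div]
        congr 1
        rw [Finset.sum_comm' (t' := Finset.univ) (s' := fun _ => Finset.univ) (by simp)]
        rw [Finset.sum_comm]
        conv_rhs => rw [Finset.sum_comm]
        refine Finset.sum_congr rfl fun p _ => ?_
        rw [Finset.sum_comm]
    _ ≤ (∑ _i : Fin n, S ^ 2) / n := by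
        gcongr with i
        · exact hsNorm_nonneg _
        · exact hS i
    _ = S ^ 2 := by simp; field_simp

theorem re_trace_avgMicMatrix_le (hn : 1 ≤ n) (M : Fin n → POVM d) {S : ℝ}
    (hS : ∀ i, micTraceNorm (M i) ≤ S) : (avgMicMatrix M).trace.re ≤ S := by
  have hn0 : (0 : ℝ) < n := by exact_mod_cast hn
  have h : (avgMicMatrix M).trace.re = (∑ i, (micMatrix (M i)).trace.re) / n := by
    rw [avgMicMatrix, Matrix.trace_smul, Matrix.trace_sum, smul_eq_mul, ← Complex.re_sum,
      ← Complex.ofReal_natCast, ← Complex.ofReal_inv, Complex.re_ofReal_mul, div_eq_inv_mul]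
  rw [h, div_le_iff₀ hn0]
  calc _ ≤ ∑ _i : Fin n, S :=
        Finset.sum_le_sum fun i _ => (re_trace_le_traceNorm _).trans (hS i)
    _ = S * n := by simp [mul_comm]

end Channel

/-! ### The average channel in the basis `V` -/

section Basis
variable {d n : ℕ}

/-- The matrix of the real bilinear form of the average channel in the family `V`. -/
noncomputable def micCoeff (M : Fin n → POVM d) (V : Fin (d ^ 2) → Matrix (Fin d) (Fin d) ℂ)
    (i j : Fin (d ^ 2)) : ℝ :=
  (star (vec (V i)) ⬝ᵥ (avgMicMatrix M *ᵥ vec (V j))).re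

/-- The change of coordinates from the standard basis to the basis `V`. -/
noncomputable def basisMatrix (V : Fin (d ^ 2) → Matrix (Fin d) (Fin d) ℂ) :
    Matrix (Fin (d ^ 2)) (Fin d × Fin d) ℂ :=
  Matrix.of fun i => star (vec (V i))

variable {V : Fin (d ^ 2) → Matrix (Fin d) (Fin d) ℂ}

theorem IsHermBasis.basisMatrix_mul_conjTranspose (hV : IsHermBasis V) :
    basisMatrix V * (basisMatrix V)ᴴ = 1 := by
  ext i j
  have h := star_vec_dotProduct_vec (V i) (V j)
  rw [hV.orthonormal] at h
  rw [Matrix.one_apply, ← h, Matrix.mul_apply]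
  simp [basisMatrix, dotProduct, Matrix.conjTranspose_apply]

theorem IsHermBasis.conjTranspose_mul_basisMatrix (hV : IsHermBasis V) :
    (basisMatrix V)ᴴ * basisMatrix V = 1 :=
  (Matrix.mul_eq_one_comm_of_card_eq _ _ _ (by simp [sq])).1 hV.basisMatrix_mul_conjTranspose

theorem micCoeff_eq (M : Fin n → POVM d) (V : Fin (d ^ 2) → Matrix (Fin d) (Fin d) ℂ)
    (i j : Fin (d ^ 2)) :
    micCoeff M V i j = ((basisMatrix V * avgMicMatrix M * (basisMatrix V)ᴴ) i j).re := by
  rw [micCoeff, Matrix.mul_assoc, Matrix.mul_apply]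
  simp [basisMatrix, dotProduct, Matrix.mul_apply, Matrix.mulVec, Matrix.conjTranspose_apply]

/-- The change of basis is unitary, so it preserves the Frobenius norm, and real parts only shrink
entries. -/
theorem sum_micCoeff_sq_le (hV : IsHermBasis V) (M : Fin n → POVM d) :
    ∑ i, ∑ j, micCoeff M V i j ^ 2 ≤ ∑ p, ∑ q, ‖avgMicMatrix M p q‖ ^ 2 := by
  set U := basisMatrix V with hU
  set C := avgMicMatrix M with hC
  have hUU : Uᴴ * U = 1 := hV.conjTranspose_mul_basisMatrix
  calc _ ≤ ∑ i, ∑ j, ‖(U * C * Uᴴ) i j‖ ^ 2 := by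
        refine Finset.sum_le_sum fun i _ => Finset.sum_le_sum fun j _ => ?_
        rw [micCoeff_eq]
        exact sq_le_sq' (abs_le.1 (Complex.abs_re_le_norm _)).1 (Complex.re_le_norm _)
    _ = _ := by
        rw [sum_norm_sq_eq_re_trace, sum_norm_sq_eq_re_trace]
        congr 1
        have : (U * C * Uᴴ)ᴴ * (U * C * Uᴴ) = U * (Cᴴ * C * Uᴴ) := by
          simp only [conjTranspose_mul, conjTranspose_conjTranspose, Matrix.mul_assoc]
          rw [← Matrix.mul_assoc Uᴴ U, hUU, Matrix.one_mul]
        rw [this, Matrix.trace_mul_comm, Matrix.mul_assoc, hUU, Matrix.mul_one]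

theorem sum_micCoeff_diag (hV : IsHermBasis V) (M : Fin n → POVM d) :
    ∑ i, micCoeff M V i i = (avgMicMatrix M).trace.re := by
  simp_rw [micCoeff_eq, ← Complex.re_sum]
  congr 1
  change (basisMatrix V * avgMicMatrix M * (basisMatrix V)ᴴ).trace = _
  rw [Matrix.mul_assoc, Matrix.trace_mul_comm, Matrix.mul_assoc,
    hV.conjTranspose_mul_basisMatrix, Matrix.mul_one]

theorem micCoeff_self_nonneg (M : Fin n → POVM d) (i : Fin (d ^ 2)) : 0 ≤ micCoeff M V i i :=
  (Complex.le_def.1 ((posSemidef_avgMicMatrix M).dotProduct_mulVec_nonneg (vec (V i)))).1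

theorem micCoeff_of_eigenbasis (hV : IsHermBasis V) (M : Fin n → POVM d)
    {ev : Fin (d ^ 2) → ℝ} (hev : ∀ i, avgMic M (V i) = ((ev i : ℝ) : ℂ) • V i)
    (i j : Fin (d ^ 2)) : micCoeff M V i j = if i = j then ev i else 0 := by
  rw [micCoeff, avgMicMatrix_mulVec_vec, hev, vec_smul, dotProduct_smul,
    star_vec_dotProduct_vec, hV.orthonormal]
  split_ifs with h <;> simp [h]

end Basis

/-! ### Reduction to the undamped chaos -/

section Exponent
variable {d n ℓ : ℕ} (c ε : ℝ) (hℓ : ℓ ≤ d ^ 2) (V : Fin (d ^ 2) → Matrix (Fin d) (Fin d) ℂ)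

/-- The factor by which `normPert` shrinks `pert`. -/
noncomputable def damping (z : Fin ℓ → ℤˣ) : ℝ := min 1 (1 / ((d : ℝ) * opNorm (pert c ε hℓ V z)))

theorem damping_nonneg (z : Fin ℓ → ℤˣ) : 0 ≤ damping c ε hℓ V z :=
  le_min zero_le_one (div_nonneg zero_le_one (mul_nonneg (Nat.cast_nonneg d) (opNorm_nonneg _)))

theorem damping_le_one (z : Fin ℓ → ℤˣ) : damping c ε hℓ V z ≤ 1 := min_le_left _ _

theorem pert_neg (z : Fin ℓ → ℤˣ) : pert c ε hℓ V (-z) = -pert c ε hℓ V z := by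
  simp [pert]

theorem damping_neg (z : Fin ℓ → ℤˣ) : damping c ε hℓ V (-z) = damping c ε hℓ V z := by
  rw [damping, damping, pert_neg, opNorm_neg]

/-- The undamped exponent. -/
noncomputable def chaos (M : Fin n → POVM d) (z z' : Fin ℓ → ℤˣ) : ℝ :=
  ∑ i, ∑ j, ((z i : ℤ) : ℝ) * ((n : ℝ) * c ^ 2 * ε ^ 2 / ℓ *
    micCoeff M V (Fin.castLE hℓ i) (Fin.castLE hℓ j)) * ((z' j : ℤ) : ℝ)

theorem chaos_neg (M : Fin n → POVM d) (z z' : Fin ℓ → ℤˣ) :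
    chaos c ε hℓ V M (-z) z' = -chaos c ε hℓ V M z z' := by
  simp [chaos]

theorem exponent_hardState (hd : 0 < d) (M : Fin n → POVM d) (z z' : Fin ℓ → ℤˣ) :
    exponent M (hardState c ε hℓ V z) (hardState c ε hℓ V z') =
      damping c ε hℓ V z * damping c ε hℓ V z' * chaos c ε hℓ V M z z' := by
  have hform : ∀ z, vec (hardState c ε hℓ V z - maxMixed d) =
      ((damping c ε hℓ V z * ((c * ε / Real.sqrt d) * (1 / Real.sqrt ℓ)) : ℝ) : ℂ) •
        ∑ i : Fin ℓ, (((z i : ℤ) : ℝ) : ℂ) • vec (V (Fin.castLE hℓ i)) := fun z => by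
    rw [hardState, add_sub_cancel_left, normPert, ← damping, pert, smul_smul,
      ← Complex.ofReal_mul, vec_smul, vec_sum]
    simp [vec_smul]
  have hbil : ∀ (C : Matrix (Fin d × Fin d) (Fin d × Fin d) ℂ) (a b : ℝ) (x y : Fin ℓ → ℝ)
      (v : Fin ℓ → Fin d × Fin d → ℂ),
      (star ((a : ℂ) • ∑ i, (x i : ℂ) • v i) ⬝ᵥ (C *ᵥ ((b : ℂ) • ∑ j, (y j : ℂ) • v j))).re =
        a * b * ∑ i, ∑ j, x i * (star (v i) ⬝ᵥ (C *ᵥ v j)).re * y j := by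
    intro C a b x y v
    simp only [star_smul, star_sum, mulVec_smul, mulVec_sum, smul_dotProduct, dotProduct_smul,
      sum_dotProduct, dotProduct_sum, smul_eq_mul, Complex.star_def, Complex.conj_ofReal]
    rw [Complex.re_ofReal_mul, Complex.re_sum, Finset.mul_sum]
    simp_rw [Complex.re_ofReal_mul, Complex.re_sum, Complex.re_ofReal_mul, Finset.mul_sum]
    rw [Finset.sum_comm]
    refine Finset.sum_congr rfl fun i _ => Finset.sum_congr rfl fun j _ => ?_
    ring
  rw [exponent, hform, hform, hbil, chaos]
  have hd' : Real.sqrt d ^ 2 = d := Real.sq_sqrt (Nat.cast_nonneg d)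
  have hl' : Real.sqrt ℓ ^ 2 = ℓ := Real.sq_sqrt (Nat.cast_nonneg ℓ)
  have hd0 : (d : ℝ) ≠ 0 := by exact_mod_cast hd.ne'
  -- The factor $d$ of the exponent cancels the two factors $1/\sqrt d$ of the perturbations.
  have hconst : (n : ℝ) * d * ((c * ε / Real.sqrt d) * (1 / Real.sqrt ℓ)) ^ 2 =
      (n : ℝ) * c ^ 2 * ε ^ 2 / ℓ := by
    rw [mul_pow, div_pow, div_pow, hd', hl']
    field_simp
  rw [← hconst]
  simp_rw [Finset.mul_sum]
  refine Finset.sum_congr rfl fun i _ => Finset.sum_congr rfl fun j _ => ?_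
  rw [micCoeff]
  ring

theorem abs_logMGF_le (hd : 0 < d) (M : Fin n → POVM d) {B : ℝ}
    (h : (𝔼 z, 𝔼 z', Real.exp (chaos c ε hℓ V M z z')) ≤ Real.exp B) :
    |logMGF c ε hℓ V M| ≤ B := by
  have hdodd : ∀ z z', damping c ε hℓ V (-z) * damping c ε hℓ V z' * chaos c ε hℓ V M (-z) z' =
      -(damping c ε hℓ V z * damping c ε hℓ V z' * chaos c ε hℓ V M z z') := fun z z' => by
    rw [damping_neg, chaos_neg, mul_neg]
  unfold logMGF
  simp_rw [exponent_hardState c ε hℓ V hd M]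
  have h1 := one_le_expect_exp_of_odd
    (X := fun z z' => damping c ε hℓ V z * damping c ε hℓ V z' * chaos c ε hℓ V M z z') hdodd
  have h2 := expect_exp_mono_of_odd
    (X := fun z z' => damping c ε hℓ V z * damping c ε hℓ V z' * chaos c ε hℓ V M z z')
    hdodd (chaos_neg c ε hℓ V M) fun z z' => by
      have h0 := mul_nonneg (damping_nonneg c ε hℓ V z) (damping_nonneg c ε hℓ V z')
      rw [abs_mul, abs_of_nonneg h0]
      exact mul_le_of_le_one_left (abs_nonneg _) <|
        mul_le_one₀ (damping_le_one c ε hℓ V z) (damping_nonneg c ε hℓ V z')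
          (damping_le_one c ε hℓ V z')
  rw [abs_of_nonneg (Real.log_nonneg h1)]
  exact (Real.log_le_iff_le_exp (zero_lt_one.trans_le h1)).2 (h2.trans h)

end Exponent
-- The two estimates
section Bounds
variable {d n ℓ : ℕ} {c ε : ℝ} {V : Fin (d ^ 2) → Matrix (Fin d) (Fin d) ℂ}

/-- Prefactor bound from `ℓ ≥ d² / 2`. -/
theorem prefactor_le (hd : 0 < d) (hl : d ^ 2 ≤ 2 * ℓ) :
    (n : ℝ) * c ^ 2 * ε ^ 2 / ℓ ≤ 2 * n * c ^ 2 * ε ^ 2 / d ^ 2 := by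
  have hd0 : (0 : ℝ) < d := by exact_mod_cast hd
  have hl' : (d : ℝ) ^ 2 ≤ 2 * ℓ := by exact_mod_cast hl
  have hl0 : (0 : ℝ) < ℓ := by nlinarith [pow_pos hd0 2]
  rw [div_le_div_iff₀ hl0 (by positivity)]
  have : 0 ≤ (n : ℝ) * c ^ 2 * ε ^ 2 := by positivity
  nlinarith

theorem abs_logMGF_le_of_micHSNorm_le (hd : 0 < d) (hn : 1 ≤ n) (hc : 0 < c) (hε : 0 < ε)
    (hℓ : ℓ ≤ d ^ 2) (hl : d ^ 2 ≤ 2 * ℓ) (hV : IsHermBasis V) (M : Fin n → POVM d) {S : ℝ}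
    (hS : ∀ i, micHSNorm (M i) ≤ S)
    (hnS : (n : ℝ) ≤ (d : ℝ) ^ 2 / (6 * c ^ 2 * ε ^ 2 * S)) :
    |logMGF c ε hℓ V M| ≤ 4 * c ^ 4 * ((n : ℝ) ^ 2 * ε ^ 4 / (d : ℝ) ^ 4 * S ^ 2) := by
  have hd0 : (0 : ℝ) < d := by exact_mod_cast hd
  have hn0 : (0 : ℝ) < n := by exact_mod_cast hn
  -- If $S=0$, the quotient in `hnS` is $0$ by the convention for division by zero, contradicting
  -- $n\ge 1$.
  have hS0 : 0 < S := by
    refine ((hsNorm_nonneg _).trans (hS ⟨0, hn⟩)).lt_of_ne fun h => ?_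
    rw [← h] at hnS
    simp at hnS
    omega
  set t : ℝ := (n : ℝ) * c ^ 2 * ε ^ 2 / ℓ with ht
  have ht0 : 0 ≤ t := by positivity
  have htle : t ≤ 2 * n * c ^ 2 * ε ^ 2 / d ^ 2 := prefactor_le hd hl
  have hF : ∑ i : Fin ℓ, ∑ j : Fin ℓ,
      (t * micCoeff M V (Fin.castLE hℓ i) (Fin.castLE hℓ j)) ^ 2 ≤ (t * S) ^ 2 := by
    have hsub : ∀ f : Fin (d ^ 2) → ℝ, (∀ i, 0 ≤ f i) →
        ∑ i : Fin ℓ, f (Fin.castLE hℓ i) ≤ ∑ i, f i := fun f hf =>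
      (Finset.sum_map Finset.univ (Fin.castLEEmb hℓ) f).symm.trans_le <|
        Finset.sum_le_univ_sum_of_nonneg hf
    simp_rw [mul_pow, ← Finset.mul_sum]
    gcongr
    calc _ ≤ ∑ i : Fin ℓ, ∑ j, micCoeff M V (Fin.castLE hℓ i) j ^ 2 :=
          Finset.sum_le_sum fun i _ => hsub _ fun _ => sq_nonneg _
      _ ≤ ∑ i, ∑ j, micCoeff M V i j ^ 2 :=
          hsub (fun i => ∑ j, micCoeff M V i j ^ 2) fun _ =>
            Finset.sum_nonneg fun _ _ => sq_nonneg _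
      _ ≤ S ^ 2 := (sum_micCoeff_sq_le hV M).trans (sum_norm_avgMicMatrix_sq_le hn M hS)
  -- The $6$ in the bound on $n$, against the $2$ from $\ell\ge d^2/2$, gives $1/3$, whose square is
  -- below the chaos threshold $1/2$.
  have htS : t * S ≤ 1 / 3 := by
    rw [le_div_iff₀ (by positivity)] at hnS
    calc t * S ≤ 2 * n * c ^ 2 * ε ^ 2 / d ^ 2 * S := by gcongr
      _ ≤ 1 / 3 := by
        rw [div_mul_eq_mul_div, div_le_div_iff₀ (by positivity) (by norm_num)]
        linarith
  have htS2 : (t * S) ^ 2 ≤ 1 / 2 := by nlinarith [mul_nonneg ht0 hS0.le]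
  refine (abs_logMGF_le c ε hℓ V hd M (expect_exp_bilin_le _ (hF.trans htS2))).trans
    (hF.trans ?_)
  calc (t * S) ^ 2 ≤ (2 * n * c ^ 2 * ε ^ 2 / d ^ 2 * S) ^ 2 := by gcongr
    _ = _ := by field_simp; ring

/-- The `i`-th smallest eigenvalue is at most the trace divided by the number of larger ones. -/
theorem eigenvalue_le (hV : IsHermBasis V) (M : Fin n → POVM d) {ev : Fin (d ^ 2) → ℝ}
    (hmono : Monotone ev) (hev : ∀ i, avgMic M (V i) = ((ev i : ℝ) : ℂ) • V i)
    (i : Fin (d ^ 2)) (hi : d ^ 2 ≤ 2 * (d ^ 2 - (i : ℕ))) :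
    (d : ℝ) ^ 2 / 2 * ev i ≤ (avgMicMatrix M).trace.re := by
  have hdiag : ∀ j, micCoeff M V j j = ev j := fun j => by
    rw [micCoeff_of_eigenbasis hV M hev, if_pos rfl]
  have hnonneg : ∀ j, 0 ≤ ev j := fun j => hdiag j ▸ micCoeff_self_nonneg M j
  have hcard : (d : ℝ) ^ 2 / 2 ≤ (d ^ 2 - (i : ℕ) : ℕ) := by
    have : (d : ℝ) ^ 2 ≤ 2 * (d ^ 2 - (i : ℕ) : ℕ) := by exact_mod_cast hi
    linarith
  calc _ ≤ ((d ^ 2 - (i : ℕ) : ℕ) : ℝ) * ev i := by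
        gcongr
        exact hnonneg i
    _ = ∑ _j ∈ Finset.Ici i, ev i := by simp
    _ ≤ ∑ j ∈ Finset.Ici i, ev j := Finset.sum_le_sum fun j hj => hmono (Finset.mem_Ici.1 hj)
    _ ≤ ∑ j, ev j := Finset.sum_le_univ_sum_of_nonneg hnonneg
    _ = _ := by rw [← sum_micCoeff_diag hV M]; simp_rw [hdiag]

/-- In the eigenbasis the chaos is $\sum_i t\lambda_i z_iz'_i$. Since $z_i^2=1$, the bound from
averaging over $z'$ is the same for every $z$. -/
theorem abs_logMGF_le_of_micTraceNorm_le (hd : 0 < d) (hn : 1 ≤ n)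
    (hℓ : ℓ ≤ d ^ 2) (hl : ℓ = (d ^ 2 + 1) / 2) (hV : IsHermBasis V) (M : Fin n → POVM d)
    (hM : IsOrderedEigenbasis M V) {S : ℝ} (hS : ∀ i, micTraceNorm (M i) ≤ S) :
    |logMGF c ε hℓ V M| ≤ 4 * c ^ 4 * ((n : ℝ) ^ 2 * ε ^ 4 / (d : ℝ) ^ 6 * S ^ 2) := by
  have hd0 : (0 : ℝ) < d := by exact_mod_cast hd
  obtain ⟨ev, hmono, hev⟩ := hM
  have hl2 : (d : ℝ) ^ 2 ≤ 2 * ℓ := by exact_mod_cast (by omega : d ^ 2 ≤ 2 * ℓ)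
  have hl0 : (0 : ℝ) < ℓ := by nlinarith [pow_pos hd0 2]
  set t : ℝ := (n : ℝ) * c ^ 2 * ε ^ 2 / ℓ with ht
  have hev0 : ∀ j, 0 ≤ ev j := fun j => by
    have := micCoeff_self_nonneg (V := V) M j
    rwa [micCoeff_of_eigenbasis hV M hev, if_pos rfl] at this
  have hevS : ∀ i : Fin ℓ, ev (Fin.castLE hℓ i) ≤ 2 * S / d ^ 2 := fun i => by
    -- Indices start at $0$, so $i<\lceil d^2/2\rceil$ leaves at least half of the eigenvalues at
    -- indices $\ge i$.
    have h := eigenvalue_le hV M hmono hev (Fin.castLE hℓ i)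
      (by have := i.2; simp only [Fin.val_castLE]; omega)
    have h' := h.trans (re_trace_avgMicMatrix_le hn M hS)
    rw [le_div_iff₀ (by positivity)]
    linarith
  have hz : ∀ z z' : Fin ℓ → ℤˣ, chaos c ε hℓ V M z z' =
      ∑ i, (t * ev (Fin.castLE hℓ i) * ((z i : ℤ) : ℝ)) * ((z' i : ℤ) : ℝ) := fun z z' => by
    refine Finset.sum_congr rfl fun i _ => ?_
    rw [Finset.sum_eq_single i]
    · rw [micCoeff_of_eigenbasis hV M hev, if_pos rfl]
      ring
    · intro j _ hj
      rw [micCoeff_of_eigenbasis hV M hev, if_neg, mul_zero, mul_zero, zero_mul]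
      exact fun h => hj (Fin.castLE_injective hℓ h).symm
    · simp
  have hE : (𝔼 z, 𝔼 z', Real.exp (chaos c ε hℓ V M z z')) ≤
      Real.exp ((∑ i : Fin ℓ, (t * ev (Fin.castLE hℓ i)) ^ 2) / 2) := by
    refine Finset.expect_le Finset.univ_nonempty fun z _ => ?_
    simp_rw [hz]
    refine (expect_exp_rademacher_le _).trans_eq ?_
    congr 2
    refine Finset.sum_congr rfl fun i _ => ?_
    rw [mul_pow _ ((z i : ℤ) : ℝ)]
    rcases Int.units_eq_one_or (z i) with h | h <;> simp [h]
  refine (abs_logMGF_le c ε hℓ V hd M hE).trans ?_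
  have ht0 : 0 ≤ t := by positivity
  calc _ ≤ (∑ _i : Fin ℓ, (t * (2 * S / d ^ 2)) ^ 2) / 2 := by
        gcongr with i
        · exact mul_nonneg ht0 (hev0 _)
        · exact hevS i
    _ = 2 * c ^ 4 * (n ^ 2 * ε ^ 4 / d ^ 4 * S ^ 2) * (ℓ : ℝ)⁻¹ := by
        simp only [Finset.sum_const, Finset.card_univ, Fintype.card_fin, nsmul_eq_mul, ht]
        field_simp
    -- Summing $\ell$ terms cancels one of the two factors $1/\ell$ in $t^2$; the other supplies the
    -- last $d^{-2}$.
    _ ≤ 2 * c ^ 4 * (n ^ 2 * ε ^ 4 / d ^ 4 * S ^ 2) * (2 / d ^ 2) := by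
        gcongr
        rw [inv_le_comm₀ hl0 (by positivity), inv_div]
        linarith
    _ = _ := by field_simp; ring

end Bounds

end QuantumCert

theorem mainTheorem12 :
    ∀ c : ℝ, 0 < c → ∃ C : ℝ, 0 < C ∧
      ∀ (d n ℓ : ℕ) (ε : ℝ) (hℓ : ℓ < d ^ 2) (V : Fin (d ^ 2) → Matrix (Fin d) (Fin d) ℂ)
        (𝔐 : Set (QuantumCert.POVM d)) (M : Fin n → QuantumCert.POVM d),
        1 ≤ n → 0 < ε → d ^ 2 ≤ 2 * ℓ → QuantumCert.IsHermBasis V → (∀ i, M i ∈ 𝔐) →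
        ((n : ℝ) ≤ (d : ℝ) ^ 2 / (6 * c ^ 2 * ε ^ 2 * sSup (QuantumCert.micHSNorm '' 𝔐)) →
          |QuantumCert.logMGF c ε hℓ.le V M| ≤
            C * ((n : ℝ) ^ 2 * ε ^ 4 / (d : ℝ) ^ 4 *
              sSup (QuantumCert.micHSNorm '' 𝔐) ^ 2)) ∧
        (QuantumCert.IsOrderedEigenbasis M V → ℓ = (d ^ 2 + 1) / 2 →
          (n : ℝ) ≤ (d : ℝ) ^ 3 / (9 * c ^ 2 * ε ^ 2 * sSup (QuantumCert.micTraceNorm '' 𝔐)) →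
          |QuantumCert.logMGF c ε hℓ.le V M| ≤
            C * ((n : ℝ) ^ 2 * ε ^ 4 / (d : ℝ) ^ 6 *
              sSup (QuantumCert.micTraceNorm '' 𝔐) ^ 2)) := by
  intro c hc
  -- In part 1 the constant is the square of the $2c^2$ in the bound on $t$; part 2 yields the same
  -- value.
  refine ⟨4 * c ^ 4, by positivity, fun d n ℓ ε hℓ V 𝔐 M hn hε hl hV hM => ?_⟩
  have hd : 0 < d := Nat.pos_of_ne_zero (by rintro rfl; simp at hℓ)
  exact ⟨fun hnS => QuantumCert.abs_logMGF_le_of_micHSNorm_le hd hn hc hε hℓ.le hl hV M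
      (fun i => le_csSup (QuantumCert.bddAbove_micHSNorm 𝔐) ⟨M i, hM i, rfl⟩) hnS,
    fun hE hl' _ => QuantumCert.abs_logMGF_le_of_micTraceNorm_le hd hn hℓ.le hl' hV M hE
      fun i => le_csSup (QuantumCert.bddAbove_micTraceNorm 𝔐) ⟨M i, hM i, rfl⟩⟩
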